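/- Let $\mathcal T$, $\mathcal X$, $\mathcal Z$ be measurable spaces, let $\Theta\sim P_\Theta$ be a random parameter in $\mathcal T$, let $P_{X|\Theta}$ be a Markov kernel from $\mathcal T$ to $\mathcal X$, and let $\ell:\mathcal T\times\mathcal T\to[0,\infty)$ be a measurable loss function. Let $\varepsilon\ge 0$ and $\delta\in[0,1]$. A Markov kernel $\mathsf K$ from $\mathcal X$ to $\mathcal Z$ is $(\varepsilon,\delta)$-LDP if $\mathsf K(A|x)-e^{\varepsilon}\mathsf K(A|x')\le\delta$ for all $x,x'\in\mathcal X$ and all measurable $A\subset\mathcal Z$; let $\mathcal Q_{\varepsilon,\delta}$ be the set of all such kernels. Given $\Theta$, let $X^n=(X_1,\dots,X_n)$ be i.i.d. from $P_{X|\Theta}$ (and write $X=X_1$), and let $Z^n=(Z_1,\dots,Z_n)$ be obtained by applying $\mathsf K$ independently to each $X_i$ (the non-interactive mechanism $\mathsf K^{\otimes n}$). The private Bayes risk is $$R_n^{\mathsf{Bayes}}(P_\Theta,\ell,\varepsilon,\delta)=\inf_{\mathsf K\in\mathcal Q_{\varepsilon,\delta}}\ \inf_{\Psi}\ \mathbb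 E[\ell(\Theta,\Psi(Z^n))],$$ where $\Psi$ ranges over measurable maps $\mathcal Z^n\to\mathcal T$. Put $\mathcal L(\zeta)=\sup_{t\in\mathcal T}\Pr(\ell(\Theta,t)\le\zeta)$ and $\varphi_n(\varepsilon,\delta)=1-e^{-n\varepsilon}(1-\delta)^n$. For $\gamma\ge 0$ let $\mathsf E_\gamma(P\|Q)=\frac12\int|\mathrm dP-\gamma\,\mathrm dQ|-\frac12|1-\gamma|$, and for random variables $(A,B)\sim P_{AB}$ with marginals $P_A,P_B$ let $I_\gamma(A;B)=\mathsf E_\gamma(P_{AB}\|P_A\otimes P_B)$. Then $$R_1^{\mathsf{Bayes}}(P_\Theta,\ell,\varepsilon,\delta)\ \ge\ \sup_{\zeta>0}\ \zeta\left[1-\delta\, I_{e^\varepsilon}(\Theta;X)-e^{\varepsilon}\mathcal L(\zeta)\right],$$ and for every $n>1$ $$R_n^{\mathsf{Bayes}}(P_\Theta,\ell,\varepsilon,\delta)\ \ge\ \sup_{\zeta>0}\ \zeta\left[1-\varphi_n(\varepsilon,\delta)\, I_{e^\varepsilon}(\Theta;X^n)-e^{\varepsilon}\mathcal L(\zeta)\right].$$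 -/

import Mathlib

open MeasureTheory ProbabilityTheory
open scoped ENNReal NNReal

namespace LDP

noncomputable section

/-- The `E_γ`-divergence (hockey-stick divergence)
`E_γ(P‖Q) = (1/2) ∫ |dP - γ dQ| - (1/2) |1 - γ|`, for `γ ≥ 0`. The integral is the total mass of
the total variation measure of the signed measure `P - γ Q`; no absolute continuity is needed. -/
def Egamma {α : Type*} [MeasurableSpace α] (γ : ℝ) (P Q : Measure α)
    [IsFiniteMeasure P] [IsFiniteMeasure Q] : ℝ :=
  (1 / 2) * (P.toSignedMeasure - γ • Q.toSignedMeasure).totalVariation.real Set.univ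
    - (1 / 2) * |1 - γ|

/-- The `E_γ`-information `I_γ(A; B) = E_γ(P_{AB} ‖ P_A ⊗ P_B)` of a pair of random variables
`(A, B)` with joint law `ρ = P_{AB}`. -/
def EgammaInfo {α β : Type*} [MeasurableSpace α] [MeasurableSpace β] (γ : ℝ)
    (ρ : Measure (α × β)) [IsProbabilityMeasure ρ] : ℝ :=
  Egamma γ ρ (ρ.fst.prod ρ.snd)

/-- A mechanism (Markov kernel) `K` is `(ε, δ)`-LDP if `K(A|x) - e^ε K(A|x') ≤ δ` for all inputs
`x, x'` and all events `A`. -/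
def IsLDP {X Z : Type*} [MeasurableSpace X] [MeasurableSpace Z] (ε δ : ℝ)
    (K : Kernel X Z) : Prop :=
  ∀ x x' : X, ∀ A : Set Z, MeasurableSet A →
    (K x).real A - Real.exp ε * (K x').real A ≤ δ

theorem measurable_measure_pi {X Z : Type*} [MeasurableSpace X] [MeasurableSpace Z]
    (n : ℕ) (K : Kernel X Z) [IsMarkovKernel K] :
    Measurable (fun x : Fin n → X => Measure.pi fun i => K (x i)) := by
  refine Measurable.measure_of_isPiSystem_of_isProbabilityMeasure generateFrom_pi.symm
    isPiSystem_pi ?_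
  rintro _ ⟨s, hs, rfl⟩
  simp only [Measure.pi_pi]
  refine Finset.measurable_prod _ fun i _ => ?_
  exact (K.measurable_coe (hs i (Set.mem_univ i))).comp (measurable_pi_apply i)

/-- The product kernel `K^{⊗n}`: independent applications of `K` to each of the `n` coordinates. -/
def productKernel {X Z : Type*} [MeasurableSpace X] [MeasurableSpace Z]
    (n : ℕ) (K : Kernel X Z) [IsMarkovKernel K] : Kernel (Fin n → X) (Fin n → Z) where
  toFun x := Measure.pi fun i => K (x i)
  measurable' := measurable_measure_pi n K

instance {X Z : Type*} [MeasurableSpace X] [MeasurableSpace Z]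
    (n : ℕ) (K : Kernel X Z) [IsMarkovKernel K] : IsMarkovKernel (productKernel n K) :=
  ⟨fun x => inferInstanceAs (IsProbabilityMeasure (Measure.pi fun i => K (x i)))⟩

/-- The conditional law of `X^n = (X_1, …, X_n)` given `Θ = θ`: i.i.d. samples from `P θ`. -/
def iidKernel {T X : Type*} [MeasurableSpace T] [MeasurableSpace X]
    (n : ℕ) (P : Kernel T X) [IsMarkovKernel P] : Kernel T (Fin n → X) :=
  (productKernel n P).comap (fun θ _ => θ) (measurable_pi_lambda _ fun _ => measurable_id)

instance {T X : Type*} [MeasurableSpace T] [MeasurableSpace X]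
    (n : ℕ) (P : Kernel T X) [IsMarkovKernel P] : IsMarkovKernel (iidKernel n P) := by
  unfold iidKernel; infer_instance

/-- The private Bayes risk `R_n^Bayes(P_Θ, ℓ, ε, δ)`: the infimum of `E[ℓ(Θ, Ψ(Z^n))]` over all
`(ε, δ)`-LDP mechanisms `K` from `X` to `Z` and all estimators `Ψ : Z^n → T`, where `Θ ∼ π`, the
`X_i` are i.i.d. from `P θ` given `Θ = θ`, and `Z^n` is the output of `K^{⊗n}` on `X^n`. -/
def privateBayesRisk {T X : Type*} (Z : Type*) [MeasurableSpace T] [MeasurableSpace X]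
    [MeasurableSpace Z] (n : ℕ) (π : Measure T) (P : Kernel T X) [IsMarkovKernel P]
    (ℓ : T × T → ℝ≥0) (ε δ : ℝ) : ℝ≥0∞ :=
  ⨅ (K : Kernel X Z) (_ : IsMarkovKernel K) (_ : IsLDP ε δ K)
    (Ψ : (Fin n → Z) → T) (_ : Measurable Ψ),
    ∫⁻ p, (ℓ (p.1, Ψ p.2) : ℝ≥0∞) ∂(π ⊗ₘ (productKernel n K ∘ₖ iidKernel n P))

/-- `𝓛(ζ) = sup_t Pr(ℓ(Θ, t) ≤ ζ)` for `Θ ∼ π`. -/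
def smallBall {T : Type*} [MeasurableSpace T] (π : Measure T) (ℓ : T × T → ℝ≥0) (ζ : ℝ) : ℝ :=
  ⨆ t : T, π.real {θ | (ℓ (θ, t) : ℝ) ≤ ζ}

/-- `φ_n(ε, δ) = 1 - e^{-nε} (1 - δ)^n`. -/
def phi (n : ℕ) (ε δ : ℝ) : ℝ := 1 - Real.exp (-(n * ε)) * (1 - δ) ^ n

end

end LDP

/-!
Fix a mechanism `K'` on the whole sample that is `(ε, η)`-LDP, and let `W` be the joint law of
`(Θ, K'(X))`. Markov's inequality bounds the risk of an estimator `Ψ` from below by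
`ζ (1 - W(B))` with `B = {ℓ(Θ, Ψ) ≤ ζ}`. Under the product of the marginals of `W` the event `B` has
probability at most `𝓛(ζ)`, so it remains to prove the contraction
`W(B) - e^ε (W_Θ ⊗ W_Z)(B) ≤ η I_{e^ε}(Θ; X)` (`measureReal_compProd_comp_sub_le`).

The contraction is a statement on `f(θ, x) = K'(B_θ | x)`, which satisfies
`f(θ, x) ≤ γ f(θ, x') + η` with `γ = e^ε`. Write `ρ = P_{ΘX}`, `σ = P_Θ ⊗ P_X`, and let `p`, `q` be
the positive and negative parts of `ρ - γ σ`, so that `E_γ(ρ‖σ) = p(univ)`. On arbitrary measurable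
spaces `P_{X|Θ=θ} - γ P_X` need not decompose measurably in `θ`, so the argument stays on the
product space. Let `m(θ)` be the essential infimum of `f(θ, ·)` under `P_X`. It is measurable,
`f ≤ γ m + η` holds everywhere, and `m ≤ f` holds `σ`-a.e., hence `q`-a.e. because `q ≤ γ σ`. Since
`p - q` has `Θ`-marginal `(1 - γ) P_Θ`,
`∫ f dp - ∫ f dq ≤ η p(univ) + (γ - 1) (∫ m dp - ∫ m dP_Θ) ≤ η p(univ)`,
the last step because `p ≤ ρ` (`integral_sub_mul_integral_le`).

For `n = 1` the mechanism is `K` itself, with `η = δ`. For larger `n` take `K' = K^{⊗n}`: the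
`(ε, δ)`-LDP condition makes any two output laws of `K` share a component of mass
`e^{-ε} (1 - δ)`, products of these are shared components of the output laws of `K^{⊗n}`, and so
`K^{⊗n}` is `(ε, φ_n)`-LDP (`IsLDP.productKernel`).
-/

namespace LDP

/-! ### The `E_γ`-divergence as the mass of a positive part -/

section Divergence

variable {α : Type*} [MeasurableSpace α]

/-- Both sides are the supremum of `μ` and `ν`; the subtraction of measures is truncated, with
`μ - ν` and `ν - μ` the two parts of the Jordan decomposition of the difference. -/
theorem sub_add_eq_sub_add (μ ν : Measure α) [IsFiniteMeasure μ] [IsFiniteMeasure ν] :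
    (μ - ν) + ν = (ν - μ) + μ := by
  rw [← Measure.toSignedMeasure_eq_toSignedMeasure_iff, Measure.toSignedMeasure_add,
    Measure.toSignedMeasure_add]
  have h := Measure.sub_toSignedMeasure_eq_toSignedMeasure_sub (μ := μ) (ν := ν)
  rw [sub_eq_sub_iff_add_eq_add] at h
  rw [← h, add_comm]

/-- For `γ ≥ 1` the divergence is the mass of the positive part of `P - γ Q`. The term
`|1 - γ| / 2` compensates the difference of masses of the two parts exactly. -/
theorem Egamma_eq_real_sub_univ {γ : ℝ≥0} (hγ : 1 ≤ γ) (P Q : Measure α)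
    [IsProbabilityMeasure P] [IsProbabilityMeasure Q] :
    Egamma γ P Q = (P - γ • Q).real Set.univ := by
  have hs : P.toSignedMeasure - (γ : ℝ) • Q.toSignedMeasure
      = P.toSignedMeasure - (γ • Q).toSignedMeasure := by
    rw [Measure.toSignedMeasure_smul]; rfl
  have hadd : (P - γ • Q + γ • Q).real Set.univ = (γ • Q - P + P).real Set.univ := by
    rw [sub_add_eq_sub_add]
  rw [measureReal_add_apply, measureReal_add_apply, measureReal_nnreal_smul_apply,
    probReal_univ (μ := Q), probReal_univ (μ := P), mul_one] at hadd
  have hγ' : (1 : ℝ) ≤ γ := by exact_mod_cast hγ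
  rw [Egamma, hs, SignedMeasure.totalVariation, Measure.toJordanDecomposition_toSignedMeasure_sub,
    measureReal_add_apply, Measure.jordanDecompositionOfToSignedMeasureSub_posPart,
    Measure.jordanDecompositionOfToSignedMeasureSub_negPart, abs_of_nonpos (by linarith)]
  linarith

end Divergence

/-! ### Contraction of the `E_γ`-information -/

/-- The essential infimum over one variable is measurable in the other, whereas the infimum over
an uncountable set need not be. -/
theorem measurable_essInf_prod {T X : Type*} [MeasurableSpace T] [MeasurableSpace X]
    (μ : Measure X) [SFinite μ] {f : T × X → ℝ≥0∞} (hf : Measurable f) :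
    Measurable fun t => essInf (fun x => f (t, x)) μ := by
  refine measurable_of_Ici fun c => ?_
  have h : (fun t => essInf (fun x => f (t, x)) μ) ⁻¹' Set.Ici c
      = (fun t => μ (Prod.mk t ⁻¹' {p | f p < c})) ⁻¹' {0} := by
    ext t
    have h' : μ (Prod.mk t ⁻¹' {p | f p < c}) = 0 ↔ ∀ᵐ x ∂μ, c ≤ f (t, x) := by
      rw [ae_iff]; simp [Set.preimage]
    simp only [Set.mem_preimage, Set.mem_Ici, Set.mem_singleton_iff, h']
    refine ⟨fun hc => ?_, fun hc => le_essInf_of_ae_le c hc⟩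
    filter_upwards [ae_essInf_le (f := fun x => f (t, x)) (μ := μ)] with x hx
    exact hc.trans hx
  rw [h]
  exact measurable_measure_prodMk_left (measurableSet_lt hf measurable_const)
    (measurableSet_singleton 0)

/-- If `f(t, x) ≤ γ f(t, x') + η` for all `x, x'`, then `f(t, ·)` lies between `m(t)` and
`γ m(t) + η` for a measurable `m`. The upper bound holds everywhere and only the lower one almost
everywhere; `m` is the essential infimum of `f(t, ·)`. -/
theorem exists_measurable_ae_le_and_le_mul_add {T X : Type*} [MeasurableSpace T]
    [MeasurableSpace X] {γ η : ℝ} (hγ : 0 < γ) (μ : Measure X) [IsProbabilityMeasure μ]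
    {f : T × X → ℝ} (hf : Measurable f) (hf0 : ∀ p, 0 ≤ f p) (hf1 : ∀ p, f p ≤ 1)
    (hfη : ∀ t x x', f (t, x) ≤ γ * f (t, x') + η) :
    ∃ m : T → ℝ, Measurable m ∧ (∀ t, 0 ≤ m t) ∧ (∀ t, m t ≤ 1) ∧
      (∀ t, ∀ᵐ x ∂μ, m t ≤ f (t, x)) ∧ ∀ z, f z ≤ γ * m z.1 + η := by
  obtain ⟨g, hg⟩ : ∃ g : T → ℝ≥0∞, g = fun t => essInf (fun x => ENNReal.ofReal (f (t, x))) μ :=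
    ⟨_, rfl⟩
  have hgm : Measurable g := by
    rw [hg]
    exact measurable_essInf_prod μ (f := fun p => ENNReal.ofReal (f p)) hf.ennreal_ofReal
  have hgf : ∀ t, ∀ᵐ x ∂μ, g t ≤ ENNReal.ofReal (f (t, x)) := fun t => by
    rw [hg]; exact ae_essInf_le (f := fun x => ENNReal.ofReal (f (t, x)))
  have hg1 : ∀ t, g t ≤ 1 := fun t => by
    obtain ⟨x, hx⟩ := (hgf t).exists
    exact hx.trans (ENNReal.ofReal_le_one.2 (hf1 _))
  refine ⟨fun t => (g t).toReal, hgm.ennreal_toReal, fun t => ENNReal.toReal_nonneg,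
    fun t => ENNReal.toReal_mono ENNReal.one_ne_top (hg1 t), fun t => ?_, ?_⟩
  · filter_upwards [hgf t] with x hx
    exact ENNReal.toReal_le_of_le_ofReal (hf0 _) hx
  · rintro ⟨t, x⟩
    have h : ENNReal.ofReal ((f (t, x) - η) / γ) ≤ g t := by
      rw [hg]
      refine le_essInf_of_ae_le _ (ae_of_all _ fun x' => ENNReal.ofReal_le_ofReal ?_)
      rw [div_le_iff₀ hγ]
      linarith [hfη t x x']
    have h' := (ENNReal.ofReal_le_iff_le_toReal ((hg1 t).trans_lt ENNReal.one_lt_top).ne).1 h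
    rw [div_le_iff₀ hγ] at h'
    linarith

/-- Functional form of the contraction of `E_γ`: a function whose sections obey the LDP inequality
separates the joint law from the product of its marginals by at most `η` times the
`E_γ`-information. -/
theorem integral_sub_mul_integral_le {T X : Type*} [MeasurableSpace T] [MeasurableSpace X]
    {γ : ℝ≥0} (hγ : 1 ≤ γ) (η : ℝ) (ρ : Measure (T × X)) [IsProbabilityMeasure ρ]
    {f : T × X → ℝ} (hf : Measurable f) (hf0 : ∀ p, 0 ≤ f p) (hf1 : ∀ p, f p ≤ 1)
    (hfη : ∀ t x x', f (t, x) ≤ γ * f (t, x') + η) :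
    ∫ p, f p ∂ρ - γ * ∫ p, f p ∂(ρ.fst.prod ρ.snd) ≤ η * EgammaInfo γ ρ := by
  have hγ' : (1 : ℝ) ≤ γ := by exact_mod_cast hγ
  set σ : Measure (T × X) := ρ.fst.prod ρ.snd with hσ
  set p := ρ - γ • σ
  set q := γ • σ - ρ
  have hE : EgammaInfo γ ρ = p.real Set.univ := Egamma_eq_real_sub_univ hγ ρ σ
  -- `ρ - γ σ = p - q`, rearranged so that only positive measures appear
  have hadd : p + γ • σ = q + ρ := sub_add_eq_sub_add ρ (γ • σ)
  have hpρ : p ≤ ρ := Measure.sub_le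
  have hqσ : q ≤ γ • σ := Measure.sub_le
  have : IsFiniteMeasure p := isFiniteMeasure_of_le ρ hpρ
  have : IsFiniteMeasure q := isFiniteMeasure_of_le _ hqσ
  obtain ⟨m, hm, hm0, hm1, hmf', hfm⟩ := exists_measurable_ae_le_and_le_mul_add
    (one_pos.trans_le hγ') ρ.snd hf hf0 hf1 hfη
  have hmf : ∀ᵐ z ∂σ, m z.1 ≤ f z :=
    (Measure.ae_prod_iff_ae_ae (measurableSet_le (hm.comp measurable_fst) hf)).2
      (ae_of_all _ hmf')
  have hfi : ∀ (μ : Measure (T × X)) [IsFiniteMeasure μ], Integrable f μ := fun μ _ =>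
    Integrable.of_bound hf.aestronglyMeasurable 1
      (ae_of_all _ fun z => by rw [Real.norm_of_nonneg (hf0 z)]; exact hf1 z)
  have hmi : ∀ (μ : Measure (T × X)) [IsFiniteMeasure μ], Integrable (fun z => m z.1) μ :=
    fun μ _ => Integrable.of_bound (hm.comp measurable_fst).aestronglyMeasurable 1
      (ae_of_all _ fun z => by rw [Real.norm_of_nonneg (hm0 _)]; exact hm1 _)
  have hintf : ∫ z, f z ∂p + γ * ∫ z, f z ∂σ = ∫ z, f z ∂q + ∫ z, f z ∂ρ := by
    rw [← integral_add_measure (hfi q) (hfi ρ), ← hadd,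
      integral_add_measure (hfi p) (hfi _), integral_smul_nnreal_measure, NNReal.smul_def,
      smul_eq_mul]
  have hintm : ∫ z, m z.1 ∂p + γ * ∫ z, m z.1 ∂σ = ∫ z, m z.1 ∂q + ∫ z, m z.1 ∂ρ := by
    rw [← integral_add_measure (hmi q) (hmi ρ), ← hadd,
      integral_add_measure (hmi p) (hmi _), integral_smul_nnreal_measure, NNReal.smul_def,
      smul_eq_mul]
  -- `ρ` and `σ` have the same first marginal
  have hmarg : ∫ z, m z.1 ∂σ = ∫ z, m z.1 ∂ρ := by
    have h1 : ∫ z, m z.1 ∂σ = ∫ t, m t ∂ρ.fst := by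
      rw [hσ, integral_fun_fst]; simp
    rw [h1, Measure.fst, integral_map measurable_fst.aemeasurable hm.aestronglyMeasurable]
  have hpos : ∫ z, f z ∂p ≤ γ * ∫ z, m z.1 ∂p + η * p.real Set.univ := by
    calc ∫ z, f z ∂p ≤ ∫ z, (γ * m z.1 + η) ∂p :=
          integral_mono (hfi p) (((hmi p).const_mul _).add (integrable_const _)) hfm
      _ = _ := by
          rw [integral_add ((hmi p).const_mul _) (integrable_const _), integral_const_mul]
          simp [mul_comm]
  have hneg : ∫ z, m z.1 ∂q ≤ ∫ z, f z ∂q :=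
    integral_mono_ae (hmi q) (hfi q)
      (ae_mono hqσ (Measure.ae_smul_measure hmf γ))
  have hle : ∫ z, m z.1 ∂p ≤ ∫ z, m z.1 ∂ρ :=
    integral_mono_measure hpρ (ae_of_all _ fun z => hm0 z.1) (hmi ρ)
  rw [hE]
  have hfin := mul_le_mul_of_nonneg_left hle (sub_nonneg.2 hγ')
  rw [hmarg] at hintm
  linarith

/-! ### Total variation of product measures -/

section TotalVariation

theorem pi_mono {ι : Type*} [Fintype ι] {Z : ι → Type*} [∀ i, MeasurableSpace (Z i)]
    {μ ν : ∀ i, Measure (Z i)} [∀ i, SigmaFinite (μ i)] (h : ∀ i, μ i ≤ ν i) :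
    Measure.pi μ ≤ Measure.pi ν := by
  refine Measure.le_iff.2 fun s hs => ?_
  have hle : (Measure.pi μ).toOuterMeasure ≤
      OuterMeasure.pi fun i => (ν i).toOuterMeasure := by
    rw [OuterMeasure.le_pi]
    intro t _
    exact (Measure.pi_pi μ t).le.trans (Finset.prod_le_prod' fun i _ => h i (t i))
  have hν : Measure.pi ν s = OuterMeasure.pi (fun i => (ν i).toOuterMeasure) s := by
    rw [Measure.pi, toMeasure_apply _ _ hs]
  exact hν ▸ hle s

/-- Two probability measures whose tests all have total error at least `c` have a common component
of mass at least `c`: their minimum, glued together along a Hahn decomposition. -/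
theorem exists_le_le_measureReal_univ_ge {Z : Type*} [MeasurableSpace Z] (μ ν : Measure Z)
    [IsProbabilityMeasure μ] [IsProbabilityMeasure ν] {c : ℝ}
    (h : ∀ A, MeasurableSet A → c ≤ μ.real Aᶜ + ν.real A) :
    ∃ κ : Measure Z, κ ≤ μ ∧ κ ≤ ν ∧ c ≤ κ.real Set.univ := by
  obtain ⟨s, hs⟩ := exists_isHahnDecomposition μ ν
  refine ⟨μ.restrict s + ν.restrict sᶜ, ?_, ?_, ?_⟩
  · calc μ.restrict s + ν.restrict sᶜ ≤ μ.restrict s + μ.restrict sᶜ := by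
          exact add_le_add le_rfl hs.ge_on_compl
      _ = μ := Measure.restrict_add_restrict_compl hs.measurableSet
  · calc μ.restrict s + ν.restrict sᶜ ≤ ν.restrict s + ν.restrict sᶜ := by
          exact add_le_add hs.le_on le_rfl
      _ = ν := Measure.restrict_add_restrict_compl hs.measurableSet
  · have := h sᶜ hs.measurableSet.compl
    rwa [measureReal_add_apply, measureReal_restrict_apply_univ, measureReal_restrict_apply_univ,
      ← compl_compl s, compl_compl sᶜ]

/-- Tensorization of total variation. The product of the common components of the factors is a
common component of mass at least `c ^ n` of the two products. -/
theorem pi_measureReal_sub_le {n : ℕ} {Z : Type*} [MeasurableSpace Z] (μ ν : Fin n → Measure Z)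
    [∀ i, IsProbabilityMeasure (μ i)] [∀ i, IsProbabilityMeasure (ν i)] {c : ℝ} (hc : 0 ≤ c)
    (h : ∀ i A, MeasurableSet A → c ≤ (μ i).real Aᶜ + (ν i).real A)
    {A : Set (Fin n → Z)} (hA : MeasurableSet A) :
    (Measure.pi μ).real A - (Measure.pi ν).real A ≤ 1 - c ^ n := by
  choose κ hκμ hκν hκ using fun i => exists_le_le_measureReal_univ_ge (μ i) (ν i) (h i)
  have : ∀ i, IsFiniteMeasure (κ i) := fun i => isFiniteMeasure_of_le _ (hκμ i)
  have hcn : c ^ n ≤ (Measure.pi κ).real Set.univ := by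
    rw [Measure.real, Measure.pi_univ, ENNReal.toReal_prod]
    calc c ^ n = ∏ _i : Fin n, c := by simp
      _ ≤ _ := Finset.prod_le_prod (fun _ _ => hc) fun i _ => hκ i
  have h1 : (Measure.pi κ).real A ≤ (Measure.pi ν).real A :=
    ENNReal.toReal_mono (measure_ne_top _ _) (pi_mono hκν A)
  have h2 : (Measure.pi κ).real Aᶜ ≤ (Measure.pi μ).real Aᶜ :=
    ENNReal.toReal_mono (measure_ne_top _ _) (pi_mono hκμ Aᶜ)
  have h3 := measureReal_add_measureReal_compl (μ := Measure.pi κ) hA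
  have h4 := measureReal_add_measureReal_compl (μ := Measure.pi μ) hA
  rw [probReal_univ] at h4
  linarith

end TotalVariation

/-! ### LDP mechanisms and the Bayes risk -/

section Mechanism

variable {T X Z : Type*} [MeasurableSpace T] [MeasurableSpace X] [MeasurableSpace Z]

/-- An LDP mechanism forces every test between two inputs to have total error at least
`e^{-ε} (1 - δ)`. -/
theorem IsLDP.le_add {ε δ : ℝ} (hε : 0 ≤ ε) {K : Kernel X Z} [IsMarkovKernel K]
    (hK : IsLDP ε δ K) (x x' : X) {A : Set Z} (hA : MeasurableSet A) :
    Real.exp (-ε) * (1 - δ) ≤ (K x).real Aᶜ + (K x').real A := by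
  have h := hK x x' A hA
  have h1 := probReal_compl_eq_one_sub (μ := K x) hA
  have he : Real.exp (-ε) * Real.exp ε = 1 := by rw [← Real.exp_add]; simp
  have hle : Real.exp (-ε) ≤ 1 := Real.exp_le_one_iff.2 (by linarith)
  calc Real.exp (-ε) * (1 - δ)
      ≤ Real.exp (-ε) * ((K x).real Aᶜ + Real.exp ε * (K x').real A) := by
        gcongr; linarith
    _ = Real.exp (-ε) * (K x).real Aᶜ + (K x').real A := by
        rw [mul_add, ← mul_assoc, he, one_mul]
    _ ≤ _ := by
        gcongr
        exact mul_le_of_le_one_left measureReal_nonneg hle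

theorem IsLDP.productKernel {ε δ : ℝ} (hε : 0 ≤ ε) (hδ : δ ≤ 1) {K : Kernel X Z}
    [IsMarkovKernel K] (hK : IsLDP ε δ K) (n : ℕ) :
    IsLDP ε (phi n ε δ) (productKernel n K) := by
  intro x x' A hA
  have h := pi_measureReal_sub_le (fun i => K (x i)) (fun i => K (x' i))
    (mul_nonneg (Real.exp_nonneg (-ε)) (sub_nonneg.2 hδ))
    (fun i B hB => hK.le_add hε (x i) (x' i) hB) hA
  have hphi : phi n ε δ = 1 - (Real.exp (-ε) * (1 - δ)) ^ n := by
    rw [phi, mul_pow, ← Real.exp_nat_mul, mul_neg]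
  rw [hphi]
  change (Measure.pi fun i => K (x i)).real A
    - Real.exp ε * (Measure.pi fun i => K (x' i)).real A ≤ _
  have h1 : (Measure.pi fun i => K (x' i)).real A
      ≤ Real.exp ε * (Measure.pi fun i => K (x' i)).real A :=
    le_mul_of_one_le_left measureReal_nonneg (Real.one_le_exp hε)
  linarith

theorem productKernel_one_const (K : Kernel X Z) [IsMarkovKernel K] (x : X) :
    LDP.productKernel 1 K (fun _ => x) = (K x).map (MeasurableEquiv.funUnique (Fin 1) Z).symm :=
  ((measurePreserving_funUnique (K x) (Fin 1)).symm _).map_eq.symm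

/-- With a single sample, the private channel from `Θ` is `K` after `P`, up to the identification
of `Fin 1 → Z` with `Z`. -/
theorem productKernel_one_comp_iidKernel_one (P : Kernel T X) [IsMarkovKernel P] (K : Kernel X Z)
    [IsMarkovKernel K] :
    LDP.productKernel 1 K ∘ₖ iidKernel 1 P
      = K.map (MeasurableEquiv.funUnique (Fin 1) Z).symm ∘ₖ P := by
  have hconst : Measurable fun (x : X) (_ : Fin 1) => x :=
    measurable_pi_lambda _ fun _ => measurable_id
  have hP : iidKernel 1 P = P.map fun x _ => x := by
    ext1 t
    rw [Kernel.map_apply _ hconst]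
    exact productKernel_one_const P t
  rw [hP, Kernel.comp_map _ _ hconst]
  congr 1
  ext1 x
  rw [Kernel.comap_apply, productKernel_one_const, Kernel.map_apply _ (MeasurableEquiv.measurable _)]

theorem IsLDP.map {Y : Type*} [MeasurableSpace Y] {ε δ : ℝ} {K : Kernel X Z} (hK : IsLDP ε δ K)
    {g : Z → Y} (hg : Measurable g) : IsLDP ε δ (K.map g) := by
  intro x x' A hA
  rw [Kernel.map_apply _ hg, Kernel.map_apply _ hg, map_measureReal_apply hg hA,
    map_measureReal_apply hg hA]
  exact hK x x' _ (hg hA)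

/-- Strong data processing: passing `X` through an `(ε, η)`-LDP mechanism contracts
`I_{e^ε}(Θ; X)` by the factor `η`, stated for a single event `B`. -/
theorem measureReal_compProd_comp_sub_le {ε η : ℝ} (hε : 0 ≤ ε) (π : Measure T)
    [IsProbabilityMeasure π] (P : Kernel T X) [IsMarkovKernel P] {K : Kernel X Z}
    [IsMarkovKernel K] (hK : IsLDP ε η K) {B : Set (T × Z)} (hB : MeasurableSet B) :
    (π ⊗ₘ (K ∘ₖ P)).real B - Real.exp ε * (π.prod (π ⊗ₘ (K ∘ₖ P)).snd).real B
      ≤ η * EgammaInfo (Real.exp ε) (π ⊗ₘ P) := by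
  obtain ⟨γ, hγ⟩ : ∃ γ : ℝ≥0, (γ : ℝ) = Real.exp ε := ⟨⟨_, Real.exp_nonneg ε⟩, rfl⟩
  have hγ1 : 1 ≤ γ := by
    have := Real.one_le_exp hε
    rw [← hγ] at this; exact_mod_cast this
  have hmeas : Measurable fun p : T × X => K p.2 (Prod.mk p.1 ⁻¹' B) :=
    Kernel.measurable_kernel_prodMk_left (κ := K.comap Prod.snd measurable_snd)
      (t := (fun q : (T × X) × Z => (q.1.1, q.2)) ⁻¹' B)
      ((measurable_fst.fst.prodMk measurable_snd) hB)
  have hint : ∀ μ : Measure (T × X), IsProbabilityMeasure μ →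
      ∫ p, (K p.2).real (Prod.mk p.1 ⁻¹' B) ∂μ
        = (∫⁻ p, K p.2 (Prod.mk p.1 ⁻¹' B) ∂μ).toReal := fun μ _ =>
    integral_toReal hmeas.aemeasurable (ae_of_all _ fun p => measure_lt_top _ _)
  have h := integral_sub_mul_integral_le hγ1 η (π ⊗ₘ P) hmeas.ennreal_toReal
    (fun p => measureReal_nonneg) (fun p => measureReal_le_one)
    (fun t x x' => by
      have := hK x x' _ (measurable_prodMk_left (x := t) hB)
      rw [hγ]
      change (K x).real _ ≤ _ * (K x').real _ + _
      linarith)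
  have h1 : (π ⊗ₘ (K ∘ₖ P)).real B = ∫ p, (K p.2).real (Prod.mk p.1 ⁻¹' B) ∂(π ⊗ₘ P) := by
    rw [hint _ inferInstance, Measure.real, Measure.compProd_apply hB,
      Measure.lintegral_compProd hmeas]
    congr 1
    refine lintegral_congr fun t => ?_
    rw [Kernel.comp_apply' _ _ _ (measurable_prodMk_left hB)]
  have h2 : (π.prod (π ⊗ₘ (K ∘ₖ P)).snd).real B
      = ∫ p, (K p.2).real (Prod.mk p.1 ⁻¹' B) ∂((π ⊗ₘ P).fst.prod (π ⊗ₘ P).snd) := by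
    rw [hint _ inferInstance, Measure.real, Measure.prod_apply hB,
      lintegral_prod _ hmeas.aemeasurable, Measure.fst_compProd]
    congr 1
    refine lintegral_congr fun t => ?_
    rw [Measure.snd_compProd, Measure.snd_compProd, ← Measure.comp_assoc,
      Measure.bind_apply (measurable_prodMk_left hB) K.aemeasurable]
  rw [h1, h2, ← hγ]
  exact h

/-- An estimate computed from data independent of `Θ` has loss at most `ζ` with probability at most
`𝓛(ζ)`. -/
theorem prod_measureReal_le_smallBall (π : Measure T) [IsProbabilityMeasure π] (μ : Measure Z)
    [IsProbabilityMeasure μ] {ℓ : T × T → ℝ≥0} (hℓ : Measurable ℓ) {Ψ : Z → T}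
    (hΨ : Measurable Ψ) (ζ : ℝ) :
    (π.prod μ).real {p | (ℓ (p.1, Ψ p.2) : ℝ) ≤ ζ} ≤ smallBall π ℓ ζ := by
  have hB : MeasurableSet {p : T × Z | (ℓ (p.1, Ψ p.2) : ℝ) ≤ ζ} := by
    refine measurableSet_le (hℓ.comp ?_).coe_nnreal_real measurable_const
    fun_prop
  have hbdd : BddAbove (Set.range fun t => π.real {θ | (ℓ (θ, t) : ℝ) ≤ ζ}) :=
    ⟨1, by rintro _ ⟨t, rfl⟩; exact measureReal_le_one⟩
  have h0 : 0 ≤ smallBall π ℓ ζ := Real.iSup_nonneg fun t => measureReal_nonneg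
  refine ENNReal.toReal_le_of_le_ofReal h0 ?_
  rw [Measure.prod_apply_symm hB]
  calc ∫⁻ z, π ((fun t => (t, z)) ⁻¹' {p : T × Z | (ℓ (p.1, Ψ p.2) : ℝ) ≤ ζ}) ∂μ
      ≤ ∫⁻ _, ENNReal.ofReal (smallBall π ℓ ζ) ∂μ := by
        refine lintegral_mono fun z => ?_
        rw [ENNReal.le_ofReal_iff_toReal_le (measure_ne_top _ _) h0]
        exact le_ciSup hbdd (Ψ z)
    _ = _ := by simp

/-- Lower bound on the Bayes risk of a fixed estimator fed by a fixed LDP mechanism. -/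
theorem le_lintegral_loss {ε η : ℝ} (hε : 0 ≤ ε) (π : Measure T)
    [IsProbabilityMeasure π] (P : Kernel T X) [IsMarkovKernel P] {K : Kernel X Z}
    [IsMarkovKernel K] (hK : IsLDP ε η K) {ℓ : T × T → ℝ≥0} (hℓ : Measurable ℓ) {Ψ : Z → T}
    (hΨ : Measurable Ψ) {ζ : ℝ} (hζ : 0 < ζ) :
    ENNReal.ofReal (ζ * (1 - η * EgammaInfo (Real.exp ε) (π ⊗ₘ P)
        - Real.exp ε * smallBall π ℓ ζ))
      ≤ ∫⁻ p, (ℓ (p.1, Ψ p.2) : ℝ≥0∞) ∂(π ⊗ₘ (K ∘ₖ P)) := by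
  set W := π ⊗ₘ (K ∘ₖ P) with hW
  set B : Set (T × Z) := {p | (ℓ (p.1, Ψ p.2) : ℝ) ≤ ζ} with hBdef
  have hm : Measurable fun p : T × Z => ℓ (p.1, Ψ p.2) := hℓ.comp (by fun_prop)
  have hB : MeasurableSet B := measurableSet_le hm.coe_nnreal_real measurable_const
  have h1 := measureReal_compProd_comp_sub_le hε π P hK hB
  have h2 : Real.exp ε * (π.prod W.snd).real B ≤ Real.exp ε * smallBall π ℓ ζ := by
    gcongr
    exact prod_measureReal_le_smallBall π W.snd hℓ hΨ ζ
  have h3 := probReal_compl_eq_one_sub (μ := W) hB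
  calc ENNReal.ofReal (ζ * (1 - η * EgammaInfo (Real.exp ε) (π ⊗ₘ P)
        - Real.exp ε * smallBall π ℓ ζ))
      ≤ ENNReal.ofReal (ζ * W.real Bᶜ) := by
        gcongr; linarith
    _ = ENNReal.ofReal ζ * W Bᶜ := by
        rw [ENNReal.ofReal_mul hζ.le, ofReal_measureReal]
    _ ≤ ENNReal.ofReal ζ * W {p | ENNReal.ofReal ζ ≤ (ℓ (p.1, Ψ p.2) : ℝ≥0∞)} := by
        gcongr
        intro p hp
        have hp' : ζ < ℓ (p.1, Ψ p.2) := not_le.1 hp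
        change ENNReal.ofReal ζ ≤ (ℓ (p.1, Ψ p.2) : ℝ≥0∞)
        rw [← ENNReal.ofReal_coe_nnreal]
        exact ENNReal.ofReal_le_ofReal hp'.le
    _ ≤ _ := mul_meas_ge_le_lintegral hm.coe_nnreal_ennreal _

end Mechanism

end LDP

theorem theorem2 {T X Z : Type*} [MeasurableSpace T] [MeasurableSpace X] [MeasurableSpace Z]
    (π : Measure T) [IsProbabilityMeasure π] (P : Kernel T X) [IsMarkovKernel P]
    (ℓ : T × T → ℝ≥0) (hℓ : Measurable ℓ)
    (ε δ : ℝ) (hε : 0 ≤ ε) (hδ₀ : 0 ≤ δ) (hδ₁ : δ ≤ 1) :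
    (⨆ (ζ : ℝ) (_ : 0 < ζ),
        ((ζ * (1 - δ * LDP.EgammaInfo (Real.exp ε) (π ⊗ₘ P)
          - Real.exp ε * LDP.smallBall π ℓ ζ) : ℝ) : EReal))
      ≤ (LDP.privateBayesRisk Z 1 π P ℓ ε δ : EReal) ∧
    ∀ n : ℕ, 1 < n →
      (⨆ (ζ : ℝ) (_ : 0 < ζ),
        ((ζ * (1 - LDP.phi n ε δ * LDP.EgammaInfo (Real.exp ε) (π ⊗ₘ LDP.iidKernel n P)
          - Real.exp ε * LDP.smallBall π ℓ ζ) : ℝ) : EReal))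
        ≤ (LDP.privateBayesRisk Z n π P ℓ ε δ : EReal) := by
  -- a negative real bound is harmless: `ENNReal.ofReal` truncates it to `0`
  have hcoe : ∀ (a : ℝ) (b : ℝ≥0∞), ENNReal.ofReal a ≤ b → (a : EReal) ≤ (b : EReal) := by
    intro a b hab
    calc (a : EReal) ≤ ((max a 0 : ℝ) : EReal) := EReal.coe_le_coe_iff.2 (le_max_left _ _)
      _ = ((ENNReal.ofReal a : ℝ≥0∞) : EReal) := EReal.coe_ennreal_ofReal.symm
      _ ≤ b := EReal.coe_ennreal_le_coe_ennreal_iff.2 hab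
  refine ⟨iSup₂_le fun ζ hζ => hcoe _ _ ?_, fun n _ => iSup₂_le fun ζ hζ => hcoe _ _ ?_⟩
  · refine le_iInf fun K => le_iInf fun hKm => le_iInf fun hK => le_iInf fun Ψ =>
      le_iInf fun hΨ => ?_
    have hg := (MeasurableEquiv.funUnique (Fin 1) Z).symm.measurable
    have : IsMarkovKernel (K.map (MeasurableEquiv.funUnique (Fin 1) Z).symm) :=
      Kernel.IsMarkovKernel.map K hg
    rw [LDP.productKernel_one_comp_iidKernel_one]
    exact LDP.le_lintegral_loss hε π P (hK.map hg) hℓ hΨ hζ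
  · refine le_iInf fun K => le_iInf fun hKm => le_iInf fun hK => le_iInf fun Ψ =>
      le_iInf fun hΨ => ?_
    exact LDP.le_lintegral_loss hε π (LDP.iidKernel n P) (hK.productKernel hε hδ₁ n) hℓ hΨ hζ
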